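/- Let $S=[0,1]^2$ with boundary $B$, and let $\Delta$ be the Euclidean distance. An instance $I=(n,k,\mathbf x,\mathbf a)$ consists of $n\ge 1$ agents at locations $x_1,\dots,x_n\in S$, facilities $F_1,\dots,F_k$, and sets $a_i\subseteq\{F_1,\dots,F_k\}$, where $a_i$ is the set of facilities that agent $i$ dislikes (or reports to dislike). Let $H_j=\{i : F_j\in a_i\}$. A solution is a vector $\mathbf y=(y_1,\dots,y_k)\in S^k$, where $F_j$ is built at $y_j$. The welfare of agent $i$ is $w(I,i,\mathbf y)=\min_{j:F_j\in a_i}\Delta(x_i,y_j)$ if $a_i\neq\emptyset$, and the maximum distance from $x_i$ to a corner of $S$ if $a_i=\emptyset$. The minimum welfare is $\mathrm{MW}(I,\mathbf y)=\min_{1\le i\le n}w(I,i,\mathbf y)$. The mechanism $M$ maps a (reported) instance $I$ to the solution $M(I)$ obtained by treating each facility $F_j$ separately, as follows. If $H_j=\emptyset$, build $F_j$ at $(0,0)$. Otherwise let $D_j$ be the Voronoi diagram of the points $x_i$, $i\in H_j$, and let $V_j$ consist of the vertices of $D_j$ in the interior of $S$, the points of $D_j\cap B$, and the four corners of $S$.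 Build $F_j$ at a point $v\in V_j$ that maximizes $\min_{i\in H_j}\Delta(v,x_i)$, breaking ties in favor of the smallest $x$-coordinate and then the smallest $y$-coordinate. **Theorem.** On all instances whose agent locations are in general position (they are distinct, no three are collinear, and no four are cocircular), for all numbers $n$ of agents and $k$ of facilities: 1. $M$ is strategyproof: if $I=(n,k,\mathbf x,\mathbf a)$ and $I'=(n,k,\mathbf x,\mathbf a')$ satisfy $a'_{i'}=a_{i'}$ for all $i'\ne i$, then $w(I,i,M(I))\ge w(I,i,M(I'))$. 2. $M$ is egalitarian: $\mathrm{MW}(I,\mathbf y)\le \mathrm{MW}(I,M(I))$ for every solution $\mathbf y\in S^k$. -/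

import Mathlib

noncomputable section

namespace DOFL

/-! The dichotomous obnoxious facility location game in the unit square. -/

/-- The Euclidean plane. -/
abbrev Plane : Type := EuclideanSpace ℝ (Fin 2)

/-- The closed unit square `[0,1]²`. -/
def unitSquare : Set Plane := {p | ∀ c : Fin 2, p c ∈ Set.Icc (0 : ℝ) 1}

/-- The four corners of the unit square; `corner (s, t)` is the point with coordinates `(s, t)`. -/
def corner (s : Fin 2 × Fin 2) : Plane := !₂[((s.1 : ℕ) : ℝ), ((s.2 : ℕ) : ℝ)]

/-- An instance with `n` agents and `k` facilities: a profile of publicly known agent locations in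
the unit square, and an aversion profile, where `aversion i` is the set of the facilities that
agent `i` dislikes (or claims to dislike). -/
structure Instance (n k : ℕ) where
  loc : Fin n → unitSquare
  aversion : Fin n → Finset (Fin k)

/-- A solution: a point of the unit square for each of the `k` facilities. -/
abbrev Solution (k : ℕ) : Type := Fin k → unitSquare

/-- A mechanism maps each reported instance, for all numbers of agents and facilities,
to a solution. -/
abbrev Mechanism : Type := ∀ n k : ℕ, Instance n k → Solution k

/-- A single-facility mechanism is defined on the instances with one facility only. -/
abbrev SingleFacilityMechanism : Type := ∀ n : ℕ, Instance n 1 → Solution 1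

namespace Instance

variable {n k : ℕ}

/-- The agents that dislike facility `j`. -/
def haters (I : Instance n k) (j : Fin k) : Finset (Fin n) :=
  Finset.univ.filter fun i => j ∈ I.aversion i

/-- The welfare of agent `i`: the distance to the nearest disliked facility and, for an agent
that dislikes no facility, the maximum distance to a corner of the square. -/
def welfare (I : Instance n k) (i : Fin n) (y : Solution k) : ℝ :=
  if h : (I.aversion i).Nonempty then
    (I.aversion i).inf' h fun j => dist (I.loc i : Plane) (y j)
  else
    Finset.univ.sup' Finset.univ_nonempty fun s => dist (I.loc i : Plane) (corner s)

/-- The minimum welfare of an agent. -/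
def minWelfare [NeZero n] (I : Instance n k) (y : Solution k) : ℝ :=
  Finset.univ.inf' Finset.univ_nonempty fun i => I.welfare i y

/-- The single-facility instance in which exactly the agents that dislike facility `j` dislike
the sole facility. -/
def single (I : Instance n k) (j : Fin k) : Instance n 1 where
  loc := I.loc
  aversion i := if i ∈ I.haters j then {0} else ∅

end Instance

/-- The agent locations are in general position: they are distinct, no three are collinear, and
no four are cocircular. -/
structure GeneralPosition {n : ℕ} (x : Fin n → unitSquare) : Prop where
  distinct : Function.Injective x
  not_collinear : ∀ a b c : Fin n, a ≠ b → a ≠ c → b ≠ c →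
    ¬ Collinear ℝ ({(x a : Plane), (x b : Plane), (x c : Plane)} : Set Plane)
  not_cocircular : ∀ a b c d : Fin n, a ≠ b → a ≠ c → a ≠ d → b ≠ c → b ≠ d → c ≠ d →
    ¬ EuclideanGeometry.Cospherical
      ({(x a : Plane), (x b : Plane), (x c : Plane), (x d : Plane)} : Set Plane)

/-- The mechanism is strategyproof on the instances with agents in general position: if `I` is
the true instance and `I'` differs from it at most in the report of agent `i`, then agent `i` is
not better off under the solution for `I'`. -/
def Mechanism.IsStrategyproof (M : Mechanism) : Prop :=
  ∀ (n k : ℕ) (I I' : Instance n k) (i : Fin n), GeneralPosition I.loc →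
    I'.loc = I.loc → (∀ i', i' ≠ i → I'.aversion i' = I.aversion i') →
    I.welfare i (M n k I') ≤ I.welfare i (M n k I)

/-- The mechanism is egalitarian on the instances with agents in general position: its solution
maximizes the minimum welfare over all solutions. -/
def Mechanism.IsEgalitarian (M : Mechanism) : Prop :=
  ∀ (n k : ℕ) [NeZero n] (I : Instance n k), GeneralPosition I.loc →
    ∀ y : Solution k, I.minWelfare y ≤ I.minWelfare (M n k I)

/-- Running a single-facility mechanism separately for each facility. -/
def parallel (M : SingleFacilityMechanism) : Mechanism :=
  fun n _ I j => M n (I.single j) 0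

/-! Voronoi diagrams. -/

/-- The Voronoi cell of the site `q` among the sites `P`. -/
def voronoiCell (P : Set Plane) (q : Plane) : Set Plane :=
  {p | ∀ r ∈ P, dist p q ≤ dist p r}

/-- The Voronoi diagram as a subset of the plane (the union of its edges and vertices): the points
that lie in the cells of at least two sites. -/
def voronoiDiagram (P : Set Plane) : Set Plane :=
  {p | ∃ q ∈ P, ∃ r ∈ P, q ≠ r ∧ p ∈ voronoiCell P q ∧ p ∈ voronoiCell P r}

/-- The vertices of the Voronoi diagram: the points that lie in the cells of at least three
sites. -/
def voronoiVertices (P : Set Plane) : Set Plane :=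
  {p | ∃ q ∈ P, ∃ r ∈ P, ∃ s ∈ P, q ≠ r ∧ q ≠ s ∧ r ≠ s ∧
    p ∈ voronoiCell P q ∧ p ∈ voronoiCell P r ∧ p ∈ voronoiCell P s}

/-- The candidate points: the Voronoi vertices in the interior of the square, the intersection
points of the Voronoi diagram with the boundary of the square, and the corners of the square. -/
def candidates (P : Set Plane) : Set Plane :=
  (voronoiVertices P ∩ interior unitSquare) ∪ (voronoiDiagram P ∩ frontier unitSquare) ∪
    Set.range corner

/-- The order used for breaking ties: first by `x`-coordinate, then by `y`-coordinate. -/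
def LexLE (p q : Plane) : Prop := p 0 < q 0 ∨ (p 0 = q 0 ∧ p 1 ≤ q 1)

/-- The locations of the agents that dislike the sole facility. -/
def haterSites {n : ℕ} (I : Instance n 1) : Set Plane :=
  (fun i => (I.loc i : Plane)) '' (I.haters 0 : Set (Fin n))

/-- The minimum distance from `v` to an agent that dislikes the sole facility. -/
def nearestHater {n : ℕ} (I : Instance n 1) (hI : (I.haters 0).Nonempty) (v : Plane) : ℝ :=
  (I.haters 0).inf' hI fun i => dist v (I.loc i)

/-- `p` is a candidate that maximizes the minimum distance to the agents that dislike the sole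
facility, and the first such candidate in the order used for breaking ties. -/
def IsBestCandidate {n : ℕ} (I : Instance n 1) (hI : (I.haters 0).Nonempty) (p : Plane) : Prop :=
  p ∈ candidates (haterSites I) ∧
  (∀ v ∈ candidates (haterSites I), nearestHater I hI v ≤ nearestHater I hI p) ∧
  ∀ v ∈ candidates (haterSites I), nearestHater I hI v = nearestHater I hI p → LexLE p v

/-! The best candidate exists and lies in the square. -/

theorem corner_mem (s : Fin 2 × Fin 2) : corner s ∈ unitSquare := by
  rcases s with ⟨a, b⟩
  intro c
  fin_cases c <;> fin_cases a <;> fin_cases b <;> simp [corner]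

theorem isClosed_unitSquare : IsClosed unitSquare := by
  have h : unitSquare = ⋂ c : Fin 2, (fun p : Plane => p c) ⁻¹' Set.Icc (0 : ℝ) 1 := by
    ext p; simp [unitSquare]
  rw [h]
  exact isClosed_iInter fun c => isClosed_Icc.preimage (by fun_prop)

theorem candidates_subset (P : Set Plane) : candidates P ⊆ unitSquare := by
  rintro p ((⟨-, h⟩ | ⟨-, h⟩) | ⟨s, rfl⟩)
  · exact interior_subset h
  · exact isClosed_unitSquare.frontier_subset h
  · exact corner_mem s

theorem coord_of_mem_frontier {p : Plane} (hp : p ∈ frontier unitSquare) :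
    ∃ c : Fin 2, p c = 0 ∨ p c = 1 := by
  by_contra! h
  have hS : p ∈ unitSquare := isClosed_unitSquare.frontier_subset hp
  have hU : IsOpen (⋂ c : Fin 2, (fun p : Plane => p c) ⁻¹' Set.Ioo (0 : ℝ) 1) :=
    isOpen_iInter_of_finite fun c => isOpen_Ioo.preimage (by fun_prop)
  refine hp.2 (interior_maximal (fun q hq c => ?_) hU ?_)
  · exact Set.Ioo_subset_Icc_self (Set.mem_iInter.1 hq c)
  · refine Set.mem_iInter.2 fun c => ?_
    exact ⟨lt_of_le_of_ne (hS c).1 (h c).1.symm, lt_of_le_of_ne (hS c).2 (h c).2⟩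

theorem finite_voronoiVertices {P : Set Plane} (hP : P.Finite) : (voronoiVertices P).Finite := by
  have hfin := (hP.prod (hP.prod hP)).biUnion
    (t := fun t : Plane × Plane × Plane =>
      {p | t.1 ≠ t.2.1 ∧ t.1 ≠ t.2.2 ∧ t.2.1 ≠ t.2.2 ∧
        dist p t.1 = dist p t.2.1 ∧ dist p t.1 = dist p t.2.2}) (by
      rintro ⟨q, r, s⟩ -
      refine Set.Subsingleton.finite ?_
      rintro p ⟨hqr, hqs, hrs, h1, h2⟩ p' ⟨-, -, -, h1', h2'⟩
      by_contra hne
      have hd : Module.finrank ℝ Plane = 2 := by simp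
      have : Fact (Module.finrank ℝ Plane = 2) := ⟨hd⟩
      rcases EuclideanGeometry.eq_of_dist_eq_of_dist_eq_of_finrank_eq_two hd hne hqr
        (r₁ := dist p q) (r₂ := dist p' q) (p := s)
        (dist_comm _ _) (by rw [dist_comm, h1]) (by rw [dist_comm, h2])
        (dist_comm _ _) (by rw [dist_comm, h1']) (by rw [dist_comm, h2']) with h | h
      · exact hqs h.symm
      · exact hrs h.symm)
  refine hfin.subset ?_
  rintro p ⟨q, hq, r, hr, s, hs, hqr, hqs, hrs, h1, h2, h3⟩
  refine Set.mem_biUnion (x := (q, r, s)) ⟨hq, hr, hs⟩ ⟨hqr, hqs, hrs, ?_, ?_⟩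
  · exact le_antisymm (h1 r hr) (h2 q hq)
  · exact le_antisymm (h1 s hs) (h3 q hq)

theorem finite_diagram_inter_frontier {P : Set Plane} (hP : P.Finite) (hS : P ⊆ unitSquare) :
    (voronoiDiagram P ∩ frontier unitSquare).Finite := by
  have hfin := ((hP.prod hP).prod (Set.finite_univ (α := Fin 2 × Fin 2))).biUnion
    (t := fun t : (Plane × Plane) × (Fin 2 × Fin 2) =>
      {p : Plane | t.1.1 ≠ t.1.2 ∧ dist p t.1.1 = dist p t.1.2 ∧
        p t.2.1 = ((t.2.2 : ℕ) : ℝ)}) (by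
      rintro ⟨⟨q, r⟩, ⟨c, e⟩⟩ ⟨⟨hq, hr⟩, -⟩
      refine Set.Subsingleton.finite ?_
      rintro p ⟨hqr, h1, h2⟩ p' ⟨-, h1', h2'⟩
      by_contra hne
      have hq0 := hS hq 0
      have hq1 := hS hq 1
      have hr0 := hS hr 0
      have hr1 := hS hr 1
      have key : ∀ u : Plane, dist u q = dist u r →
          (u 0 - q 0) ^ 2 + (u 1 - q 1) ^ 2 = (u 0 - r 0) ^ 2 + (u 1 - r 1) ^ 2 := by
        intro u hu
        have h : dist u q ^ 2 = dist u r ^ 2 := by rw [hu]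
        simpa [EuclideanSpace.dist_sq_eq, Real.dist_eq, sq_abs] using h
      have k1 := key p h1
      have k2 := key p' h1'
      have hext : ∀ u v : Plane, u 0 = v 0 → u 1 = v 1 → u = v := by
        intro u v h0 h1
        ext d
        fin_cases d
        · exact h0
        · exact h1
      simp only [Set.mem_Icc] at hq0 hq1 hr0 hr1 h2 h2'
      have aux : ∀ a b x x' s t e : ℝ, (e = 0 ∨ e = 1) → 0 ≤ a → a ≤ 1 → 0 ≤ b → b ≤ 1 →
          (e - a) ^ 2 + (x - s) ^ 2 = (e - b) ^ 2 + (x - t) ^ 2 →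
          (e - a) ^ 2 + (x' - s) ^ 2 = (e - b) ^ 2 + (x' - t) ^ 2 → x ≠ x' →
          s = t ∧ a = b := by
        intro a b x x' s t e he ha0 ha1 hb0 hb1 g1 g2 hx
        have h : (x - x') * (t - s) = 0 := by linarith
        have hst : s = t := by
          rcases mul_eq_zero.1 h with h | h
          · exact absurd (sub_eq_zero.1 h) hx
          · linarith
        subst hst
        refine ⟨rfl, ?_⟩
        have h' : (a - b) * (2 * e - a - b) = 0 := by linarith
        rcases mul_eq_zero.1 h' with h | h
        · linarith
        · rcases he with rfl | rfl <;> linarith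
      have he : ((e : ℕ) : ℝ) = 0 ∨ ((e : ℕ) : ℝ) = 1 := by
        fin_cases e <;> simp
      generalize ((e : ℕ) : ℝ) = e' at *
      fin_cases c
      · simp only [Fin.zero_eta] at h2 h2'
        rw [h2] at k1
        rw [h2'] at k2
        have hx : p 1 ≠ p' 1 := fun h => hne (hext _ _ (h2.trans h2'.symm) h)
        obtain ⟨g1, g2⟩ := aux _ _ _ _ _ _ _ he hq0.1 hq0.2 hr0.1 hr0.2 k1 k2 hx
        exact hqr (hext _ _ g2 g1)
      · simp only [Fin.mk_one] at h2 h2'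
        rw [h2, add_comm, add_comm ((p 0 - r 0) ^ 2)] at k1
        rw [h2', add_comm, add_comm ((p' 0 - r 0) ^ 2)] at k2
        have hx : p 0 ≠ p' 0 := fun h => hne (hext _ _ h (h2.trans h2'.symm))
        obtain ⟨g1, g2⟩ := aux _ _ _ _ _ _ _ he hq1.1 hq1.2 hr1.1 hr1.2 k1 k2 hx
        exact hqr (hext _ _ g1 g2))
  refine hfin.subset ?_
  rintro p ⟨⟨q, hq, r, hr, hqr, h1, h2⟩, hp⟩
  have hd : dist p q = dist p r := le_antisymm (h1 r hr) (h2 q hq)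
  obtain ⟨c, hc | hc⟩ := coord_of_mem_frontier hp
  · exact Set.mem_biUnion (x := ((q, r), (c, 0))) ⟨⟨hq, hr⟩, trivial⟩ ⟨hqr, hd, by simpa using hc⟩
  · exact Set.mem_biUnion (x := ((q, r), (c, 1))) ⟨⟨hq, hr⟩, trivial⟩ ⟨hqr, hd, by simpa using hc⟩

theorem finite_candidates {P : Set Plane} (hP : P.Finite) (hS : P ⊆ unitSquare) :
    (candidates P).Finite :=
  (((finite_voronoiVertices hP).subset Set.inter_subset_left).union
    (finite_diagram_inter_frontier hP hS)).union (Set.finite_range corner)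

theorem exists_isBestCandidate {n : ℕ} (I : Instance n 1) (hI : (I.haters 0).Nonempty) :
    ∃ p, IsBestCandidate I hI p := by
  have hfin : (candidates (haterSites I)).Finite := by
    refine finite_candidates ((Finset.finite_toSet _).image _) ?_
    rintro _ ⟨i, -, rfl⟩
    exact (I.loc i).2
  have hne : (candidates (haterSites I)).Nonempty := ⟨corner (0, 0), Or.inr ⟨_, rfl⟩⟩
  obtain ⟨m, hm, hmax⟩ := Set.exists_max_image _ (nearestHater I hI) hfin hne
  obtain ⟨m', ⟨hm', hd'⟩, hmin'⟩ := Set.exists_min_image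
    {v ∈ candidates (haterSites I) | nearestHater I hI v = nearestHater I hI m} (fun v => v 0)
    (hfin.subset (Set.sep_subset _ _)) ⟨m, hm, rfl⟩
  obtain ⟨p, ⟨hp, hd, h0⟩, hmin⟩ := Set.exists_min_image
    {v ∈ candidates (haterSites I) | nearestHater I hI v = nearestHater I hI m ∧ v 0 = m' 0}
    (fun v => v 1) (hfin.subset (Set.sep_subset _ _)) ⟨m', hm', hd', rfl⟩
  refine ⟨p, hp, fun v hv => hd.symm ▸ hmax v hv, fun v hv hvd => ?_⟩
  rcases lt_or_eq_of_le (hmin' v ⟨hv, hvd.trans hd⟩) with h | h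
  · exact Or.inl (h0.trans_lt h)
  · exact Or.inr ⟨h0.trans h, hmin v ⟨hv, hvd.trans hd, h.symm⟩⟩

/-! The mechanisms. -/

/-- The single-facility mechanism: build at `(0, 0)` if no agent dislikes the facility, and
otherwise at the best candidate. -/
def voronoiSingleMechanism : SingleFacilityMechanism := fun _ I _ =>
  if hI : (I.haters 0).Nonempty then
    ⟨Classical.choose (exists_isBestCandidate I hI),
      candidates_subset _ (Classical.choose_spec (exists_isBestCandidate I hI)).1⟩
  else ⟨corner (0, 0), corner_mem _⟩

/-- The mechanism for `k` facilities: the single-facility mechanism is run for each facility. -/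
def voronoiMechanism : Mechanism := parallel voronoiSingleMechanism

end DOFL

end

namespace DOFL

open Filter Topology

/-! For one facility, let f(v) be the distance from v to the nearest hater. Every maximizer of f
over the square is a candidate (`mem_candidates_of_isMaxOn`), since from any other point a small
move increases f. So the best candidate is the lexicographically first global maximizer of f
(`IsBestCandidate.isMaxOn`). As the minimum welfare is bounded by f for each disliked facility
separately, egalitarianism follows. For strategyproofness only a hidden aversion matters
(`dist_le_of_haters_eq_erase`). Removing agent i replaces f = min(d, f') by f', where d is the
distance to i. If a maximizer of f' were farther from i than a maximizer of f, both points would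
maximize both functions, and tie-breaking would pick the same point twice. -/

theorem le_nearestHater_iff {n : ℕ} (I : Instance n 1) (hI : (I.haters 0).Nonempty) (v : Plane)
    (r : ℝ) : r ≤ nearestHater I hI v ↔ ∀ i ∈ I.haters 0, r ≤ dist v (I.loc i) :=
  Finset.le_inf'_iff _ _

theorem nearestHater_le {n : ℕ} (I : Instance n 1) (hI : (I.haters 0).Nonempty) (v : Plane)
    {i : Fin n} (hi : i ∈ I.haters 0) : nearestHater I hI v ≤ dist v (I.loc i) :=
  Finset.inf'_le _ hi

theorem exists_nearestHater_eq {n : ℕ} (I : Instance n 1) (hI : (I.haters 0).Nonempty)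
    (v : Plane) : ∃ i ∈ I.haters 0, nearestHater I hI v = dist v (I.loc i) :=
  Finset.exists_mem_eq_inf' hI _

theorem continuous_nearestHater {n : ℕ} (I : Instance n 1) (hI : (I.haters 0).Nonempty) :
    Continuous (nearestHater I hI) :=
  Continuous.finset_inf'_apply hI fun i _ => by fun_prop

theorem isCompact_unitSquare : IsCompact unitSquare := by
  refine Metric.isCompact_of_isClosed_isBounded isClosed_unitSquare ?_
  refine (Metric.isBounded_closedBall (x := (0 : Plane)) (r := 2)).subset fun p hp => ?_
  have h0 := hp 0
  have h1 := hp 1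
  simp only [Set.mem_Icc] at h0 h1
  rw [mem_closedBall_zero_iff, EuclideanSpace.norm_eq]
  refine Real.sqrt_le_iff.2 ⟨by norm_num, ?_⟩
  simp only [Fin.sum_univ_two, Real.norm_eq_abs, sq_abs]
  nlinarith

/-- Makes the tie-breaking choice unique. -/
theorem LexLE.antisymm {p q : Plane} (h : LexLE p q) (h' : LexLE q p) : p = q := by
  unfold LexLE at h h'
  ext c
  fin_cases c <;> simp only [Fin.zero_eta, Fin.mk_one] <;> grind

/-! ### Farthest points of the square are candidates -/

/-- Moving in a direction that does not decrease the distance to any nearest site to first order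
increases the distance to the set of sites. -/
theorem not_isMaxOn_of_direction {n : ℕ} (I : Instance n 1) (hI : (I.haters 0).Nonempty)
    {p v : Plane} (hv : v ≠ 0) (hS : ∀ᶠ t : ℝ in 𝓝[>] 0, p + t • v ∈ unitSquare)
    (hdir : ∀ i ∈ I.haters 0, dist p (I.loc i) = nearestHater I hI p →
      0 ≤ inner ℝ (p - I.loc i) v) :
    ¬ IsMaxOn (nearestHater I hI) unitSquare p := by
  intro hmax
  have key : ∀ i ∈ I.haters 0, ∀ᶠ t : ℝ in 𝓝[>] 0,
      nearestHater I hI p < dist (p + t • v) (I.loc i) := by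
    intro i hi
    rcases (nearestHater_le I hI p hi).eq_or_lt with h | h
    · filter_upwards [self_mem_nhdsWithin] with t ht
      have ht : 0 < t := ht
      rw [h, dist_eq_norm, dist_eq_norm]
      refine lt_of_pow_lt_pow_left₀ 2 (norm_nonneg _) ?_
      -- In the expansion of the squared norm the linear term is nonnegative, and t²‖v‖² makes the
      -- increase strict.
      have e : p + t • v - (I.loc i : Plane) = (p - I.loc i) + t • v := by abel
      rw [e, norm_add_sq_real, inner_smul_right, norm_smul]
      have h1 := mul_nonneg ht.le (hdir i hi h.symm)
      have h2 : 0 < ‖t‖ * ‖v‖ := mul_pos (norm_pos_iff.2 ht.ne') (norm_pos_iff.2 hv)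
      nlinarith [pow_pos h2 2]
    · have hc : Continuous fun t : ℝ => dist (p + t • v) (I.loc i) := by fun_prop
      have := (hc.tendsto 0).eventually (lt_mem_nhds (a := nearestHater I hI p) (by simpa using h))
      exact this.filter_mono nhdsWithin_le_nhds
  obtain ⟨t, hS, ht⟩ := (hS.and ((Filter.eventually_all_finset _).2 key)).exists
  obtain ⟨i, hi, h⟩ := exists_nearestHater_eq I hI (p + t • v)
  have h1 : nearestHater I hI (p + t • v) ≤ nearestHater I hI p := hmax hS
  have h2 := ht i hi
  linarith

/-- Away from the corners, some coordinate direction can be followed both ways in the square. -/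
theorem exists_direction_of_not_corner {p : Plane} (hp : p ∈ unitSquare)
    (hc : p ∉ Set.range corner) :
    ∃ v : Plane, v ≠ 0 ∧ ∀ s : ℝ, ∀ᶠ t : ℝ in 𝓝[>] 0, p + t • (s • v) ∈ unitSquare := by
  have h : ∃ c : Fin 2, 0 < p c ∧ p c < 1 := by
    by_contra! h
    have h01 : ∀ c : Fin 2, ∃ e : Fin 2, p c = ((e : ℕ) : ℝ) := by
      intro c
      rcases (hp c).1.eq_or_lt with h0 | h0
      · exact ⟨0, by simpa using h0.symm⟩
      · exact ⟨1, by simpa using le_antisymm (hp c).2 (h c h0)⟩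
    obtain ⟨a, ha⟩ := h01 0
    obtain ⟨b, hb⟩ := h01 1
    refine hc ⟨(a, b), ?_⟩
    ext c
    fin_cases c
    · simp [corner, ha]
    · simp [corner, hb]
  obtain ⟨c, h0, h1⟩ := h
  -- Only the coordinate strictly between 0 and 1 moves; the other stays in range.
  refine ⟨EuclideanSpace.single c 1, by simp, fun s => ?_⟩
  have hcont : Continuous fun t : ℝ => p c + t * s := by fun_prop
  have hev := (hcont.tendsto 0).eventually (isOpen_Ioo.mem_nhds (x := p c + 0 * s)
    (s := Set.Ioo (0 : ℝ) 1) (by simpa using ⟨h0, h1⟩))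
  filter_upwards [hev.filter_mono nhdsWithin_le_nhds] with t ht d
  by_cases hd : d = c
  · subst hd
    simpa using Set.Ioo_subset_Icc_self ht
  · simpa [hd] using hp d

theorem mem_voronoiCell_haterSites {n : ℕ} {I : Instance n 1} (hI : (I.haters 0).Nonempty)
    {p : Plane} {q : Plane} (hq : dist p q ≤ nearestHater I hI p) :
    p ∈ voronoiCell (haterSites I) q := by
  rintro _ ⟨i, hi, rfl⟩
  exact hq.trans (nearestHater_le I hI p hi)

/-- Every point of the square that is farthest from the sites is a candidate. -/
theorem mem_candidates_of_isMaxOn {n : ℕ} (I : Instance n 1) (hI : (I.haters 0).Nonempty)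
    {p : Plane} (hp : p ∈ unitSquare) (hmax : IsMaxOn (nearestHater I hI) unitSquare p) :
    p ∈ candidates (haterSites I) := by
  by_contra hcand
  simp only [candidates, Set.mem_union, not_or, Set.mem_inter_iff, not_and] at hcand
  obtain ⟨⟨hvert, hdiag⟩, hcorner⟩ := hcand
  obtain ⟨i, hi, hpi⟩ := exists_nearestHater_eq I hI p
  by_cases hD : p ∈ voronoiDiagram (haterSites I)
  · have hint : p ∈ interior unitSquare := by
      by_contra h
      exact hdiag hD ⟨subset_closure hp, h⟩
    obtain ⟨q, hq, r, hr, hqr, hpq, hpr⟩ := hD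
    -- A third nearest site would make p an interior Voronoi vertex, hence a candidate.
    have hnear : ∀ i ∈ I.haters 0, dist p (I.loc i) = nearestHater I hI p →
        (I.loc i : Plane) = q ∨ (I.loc i : Plane) = r := by
      intro i hi h
      by_contra! hne
      exact hvert ⟨q, hq, r, hr, I.loc i, ⟨i, hi, rfl⟩, hqr, hne.1.symm, hne.2.symm, hpq, hpr,
        mem_voronoiCell_haterSites hI h.le⟩ hint
    -- w is q - r rotated by a right angle, so it points along the bisector. There p - q and p - r
    -- have equal inner products with w, and one choice of sign serves both sites.
    have hw : ∃ w : Plane, w ≠ 0 ∧ inner ℝ (q - r) w = 0 := by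
      refine ⟨!₂[-((q - r) 1), (q - r) 0], fun h => hqr ?_, ?_⟩
      · have h0 : r 1 - q 1 = 0 := by simpa using congrArg (fun u : Plane => u 0) h
        have h1 : q 0 - r 0 = 0 := by simpa using congrArg (fun u : Plane => u 1) h
        ext c
        fin_cases c <;> simp only [Fin.zero_eta, Fin.mk_one] <;> linarith
      · simp [PiLp.inner_apply, Fin.sum_univ_two]
        ring
    obtain ⟨w, hw0, hw⟩ := hw
    have hdir : ∃ v : Plane, v ≠ 0 ∧ inner ℝ (q - r) v = 0 ∧ 0 ≤ inner ℝ (p - q) v := by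
      rcases le_total 0 (inner ℝ (p - q) w) with h | h
      · exact ⟨w, hw0, hw, h⟩
      · exact ⟨-w, neg_ne_zero.2 hw0, by simp [hw], by rw [inner_neg_right]; linarith⟩
    obtain ⟨v, hv0, hv, hpv⟩ := hdir
    refine not_isMaxOn_of_direction I hI hv0 ?_ (fun i hi h => ?_) hmax
    · have hc : Continuous fun t : ℝ => p + t • v := by fun_prop
      exact ((hc.tendsto 0).eventually (by
        simpa using mem_interior_iff_mem_nhds.1 hint)).filter_mono nhdsWithin_le_nhds
    · rcases hnear i hi h with e | e
      · rwa [e]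
      · rw [e, ← sub_add_sub_cancel p q r, inner_add_left, hv, add_zero]
        exact hpv
  -- Off the diagram there is one nearest site, so v or -v leads away from it.
  · obtain ⟨v, hv0, hv⟩ := exists_direction_of_not_corner hp hcorner
    have hnear : ∀ i' ∈ I.haters 0, dist p (I.loc i') = nearestHater I hI p →
        (I.loc i' : Plane) = I.loc i := by
      intro i' hi' h
      by_contra hne
      exact hD ⟨_, ⟨i', hi', rfl⟩, _, ⟨i, hi, rfl⟩, hne, mem_voronoiCell_haterSites hI h.le,
        mem_voronoiCell_haterSites hI hpi.ge⟩
    rcases le_total 0 (inner ℝ (p - I.loc i) v) with h | h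
    · refine not_isMaxOn_of_direction I hI hv0 (by simpa using hv 1) (fun i' hi' h' => ?_) hmax
      rwa [hnear i' hi' h']
    · refine not_isMaxOn_of_direction I hI (neg_ne_zero.2 hv0) (by simpa using hv (-1))
        (fun i' hi' h' => ?_) hmax
      rw [hnear i' hi' h', inner_neg_right]
      linarith

/-- The best candidate is at least as far from the sites as every point of the square. -/
theorem IsBestCandidate.isMaxOn {n : ℕ} {I : Instance n 1} {hI : (I.haters 0).Nonempty}
    {p : Plane} (hp : IsBestCandidate I hI p) : IsMaxOn (nearestHater I hI) unitSquare p := by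
  obtain ⟨m, hm, hmax⟩ := isCompact_unitSquare.exists_isMaxOn ⟨_, corner_mem (0, 0)⟩
    (continuous_nearestHater I hI).continuousOn
  exact fun v hv => (hmax hv).trans (hp.2.1 m (mem_candidates_of_isMaxOn I hI hm hmax))

theorem voronoiSingleMechanism_isBestCandidate {n : ℕ} (I : Instance n 1)
    (hI : (I.haters 0).Nonempty) :
    IsBestCandidate I hI (voronoiSingleMechanism n I 0 : Plane) := by
  simp only [voronoiSingleMechanism, dif_pos hI]
  exact Classical.choose_spec (exists_isBestCandidate I hI)

/-! ### Strategyproofness for one facility -/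

/-- An agent that hides its aversion to the sole facility does not get farther from it. -/
theorem dist_le_of_haters_eq_erase {n : ℕ} {I I' : Instance n 1} {i : Fin n}
    (hloc : I'.loc = I.loc) (hi : i ∈ I.haters 0) (hers : I'.haters 0 = (I.haters 0).erase i) :
    dist (I.loc i : Plane) (voronoiSingleMechanism n I' 0) ≤
      dist (I.loc i : Plane) (voronoiSingleMechanism n I 0) := by
  have hI : (I.haters 0).Nonempty := ⟨i, hi⟩
  have hb := voronoiSingleMechanism_isBestCandidate I hI
  have hpS := (voronoiSingleMechanism n I 0).2
  have hpS' := (voronoiSingleMechanism n I' 0).2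
  by_cases hI' : (I'.haters 0).Nonempty
  · have hb' := voronoiSingleMechanism_isBestCandidate I' hI'
    generalize (voronoiSingleMechanism n I 0 : Plane) = p at *
    generalize (voronoiSingleMechanism n I' 0 : Plane) = p' at *
    by_contra! hlt
    rw [dist_comm _ p, dist_comm _ p'] at hlt
    have hmin : ∀ v, nearestHater I hI v = min (dist v (I.loc i)) (nearestHater I' hI' v) := by
      intro v
      refine eq_of_forall_le_iff fun r => ?_
      rw [le_min_iff, le_nearestHater_iff, le_nearestHater_iff, hers, hloc]
      refine ⟨fun h => ⟨h i hi, fun j hj => h j (Finset.mem_of_mem_erase hj)⟩, fun h j hj => ?_⟩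
      by_cases hji : j = i
      · exact hji ▸ h.1
      · exact h.2 j (Finset.mem_erase.2 ⟨hji, hj⟩)
    have hm : nearestHater I hI p' ≤ nearestHater I hI p := hb.isMaxOn hpS'
    have hm' : nearestHater I' hI' p ≤ nearestHater I' hI' p' := hb'.isMaxOn hpS
    have hpp := hmin p
    have hpp' := hmin p'
    -- As f(p') ≤ f(p) ≤ d(p) < d(p'), the minimum at p' is f'(p'). Then f'(p') = f(p') ≤ f(p) ≤
    -- f'(p) ≤ f'(p'): if f(p') < f(p), then f'(p') < f'(p), a contradiction.
    have hg : nearestHater I hI p' = nearestHater I hI p ∧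
        nearestHater I' hI' p = nearestHater I' hI' p' ∧
        nearestHater I' hI' p' ≤ dist p' (I.loc i) := by grind
    obtain ⟨hg, hf, hfd⟩ := hg
    have hpmax : IsMaxOn (nearestHater I' hI') unitSquare p := fun v hv =>
      (hb'.isMaxOn hv).trans hf.ge
    have hle' := hb'.2.2 p (mem_candidates_of_isMaxOn I' hI' hpS hpmax) hf
    have hp'max : IsMaxOn (nearestHater I hI) unitSquare p' := fun v hv =>
      (hb.isMaxOn hv).trans hg.ge
    have hle := hb.2.2 p' (mem_candidates_of_isMaxOn I hI hpS' hp'max) hg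
    rw [hle.antisymm hle'] at hlt
    exact lt_irrefl _ hlt
  -- Agent i is the only hater, so f is its own distance, which the truthful outcome maximizes.
  · have hsub : I.haters 0 = {i} := by
      refine Finset.eq_singleton_iff_unique_mem.2 ⟨hi, fun j hj => ?_⟩
      by_contra hji
      exact hI' ⟨j, hers ▸ Finset.mem_erase.2 ⟨hji, hj⟩⟩
    have hm : nearestHater I hI (voronoiSingleMechanism n I' 0) ≤
      nearestHater I hI (voronoiSingleMechanism n I 0) := hb.isMaxOn hpS'
    simpa [nearestHater, hsub, dist_comm] using hm

/-! ### Several facilities -/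

@[simp] theorem Instance.mem_haters {n k : ℕ} (I : Instance n k) (j : Fin k) (i : Fin n) :
    i ∈ I.haters j ↔ j ∈ I.aversion i := by
  simp [Instance.haters]

theorem Instance.haters_single {n k : ℕ} (I : Instance n k) (j : Fin k) :
    (I.single j).haters 0 = I.haters j := by
  ext i
  by_cases h : i ∈ I.haters j
  · simp [Instance.single, (I.mem_haters j i).1 h]
  · have h' : j ∉ I.aversion i := fun hj => h ((I.mem_haters j i).2 hj)
    simp [Instance.single, h']

theorem Instance.single_congr {n k : ℕ} {I I' : Instance n k} {j : Fin k}
    (hloc : I'.loc = I.loc) (h : I'.haters j = I.haters j) : I'.single j = I.single j := by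
  simp only [Instance.single, hloc, h]

/-- Welfare involves only truly disliked facilities. Each is either still reported, so its location
is unchanged, or hidden, so it gets no farther away. -/
theorem voronoiMechanism_isStrategyproof : voronoiMechanism.IsStrategyproof := by
  intro n k I I' i _ hloc hav
  unfold Instance.welfare
  split_ifs with h
  · refine Finset.le_inf' _ _ fun j hj => (Finset.inf'_le _ hj).trans ?_
    by_cases hj' : j ∈ I'.aversion i
    · have he : I'.haters j = I.haters j := by
        ext i'
        by_cases hi : i' = i
        · subst hi; simp [hj, hj']
        · simp [hav i' hi]
      simp only [voronoiMechanism, parallel, Instance.single_congr hloc he, le_refl]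
    · refine dist_le_of_haters_eq_erase (I := I.single j) (I' := I'.single j) (i := i) hloc ?_ ?_
      · simpa [Instance.haters_single] using hj
      · rw [Instance.haters_single, Instance.haters_single]
        ext i'
        by_cases hi : i' = i
        · subst hi; simp [hj']
        · simp [hav i' hi, hi]
  · exact le_rfl

theorem voronoiMechanism_isEgalitarian : voronoiMechanism.IsEgalitarian := by
  intro n k _ I _ y
  have hle : ∀ i, I.minWelfare y ≤ I.welfare i y := fun i => Finset.inf'_le _ (Finset.mem_univ i)
  refine Finset.le_inf' _ _ fun i _ => ?_
  by_cases h : (I.aversion i).Nonempty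
  · rw [Instance.welfare, dif_pos h]
    refine Finset.le_inf' _ _ fun j hj => ?_
    have hi : i ∈ (I.single j).haters 0 := by simpa [Instance.haters_single] using hj
    have hI : ((I.single j).haters 0).Nonempty := ⟨i, hi⟩
    have hb := voronoiSingleMechanism_isBestCandidate _ hI
    -- The hater nearest to y j has welfare at most its distance to y j, which links the minimum
    -- welfare to f.
    obtain ⟨i', hi', he⟩ := exists_nearestHater_eq _ hI (y j)
    rw [Instance.haters_single, Instance.mem_haters] at hi'
    calc I.minWelfare y ≤ I.welfare i' y := hle i'
      _ ≤ dist (I.loc i' : Plane) (y j) := by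
        rw [Instance.welfare, dif_pos ⟨j, hi'⟩]
        exact Finset.inf'_le _ hi'
      _ = nearestHater (I.single j) hI (y j) := by rw [he, dist_comm]; rfl
      _ ≤ nearestHater (I.single j) hI (voronoiMechanism n k I j) := hb.isMaxOn (y j).2
      _ ≤ dist (voronoiMechanism n k I j : Plane) (I.loc i) := nearestHater_le _ hI _ hi
      _ = dist (I.loc i : Plane) (voronoiMechanism n k I j) := dist_comm _ _
  -- With no disliked facility, welfare does not depend on the solution.
  · refine (hle i).trans (le_of_eq ?_)
    simp only [Instance.welfare, dif_neg h]

end DOFL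

theorem mainTheorem12 :
    DOFL.Mechanism.IsStrategyproof DOFL.voronoiMechanism ∧
      DOFL.Mechanism.IsEgalitarian DOFL.voronoiMechanism :=
  ⟨DOFL.voronoiMechanism_isStrategyproof, DOFL.voronoiMechanism_isEgalitarian⟩
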